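/- Let $\mathcal H$ be a complex Hilbert space, with inner product $\langle\cdot,\cdot\rangle$ linear in the first argument. An operator $T$ on $\mathcal H$ with domain $\mathrm{Dom}(T)$ is called dissipative if $\operatorname{Im}\langle T\varphi,\varphi\rangle\le 0$ for all $\varphi\in\mathrm{Dom}(T)$, and maximal dissipative if moreover it has no dissipative extension on $\mathcal H$ other than itself. Let $q_0$ be a closed, densely defined, symmetric sesquilinear form on $\mathcal H$ (linear in the first argument and antilinear in the second) which is bounded from below. Let $q_\Theta$ be a symmetric, non-negative form on $\mathcal H$ which is $q_0$-bounded: $\mathrm{Dom}(q_0)\subset\mathrm{Dom}(q_\Theta)$ and there is $C_\Theta\ge 0$ such that $$|q_\Theta(\varphi,\varphi)|\le C_\Theta\left(|q_0(\varphi,\varphi)|+\|\varphi\|^2\right)\qquad\text{for all }\varphi\in\mathrm{Dom}(q_0).$$ Put $q=q_0-iq_\Theta$, with $\mathrm{Dom}(q)=\mathrm{Dom}(q_0)\cap\mathrm{Dom}(q_\Theta)=\mathrm{Dom}(q_0)$. Then there exists a unique maximal dissipative operator $H$ on $\mathcal H$ such that $\mathrm{Dom}(H)\subset\mathrm{Dom}(q)$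 and $$\langle H\varphi,\psi\rangle=q(\varphi,\psi)\qquad\text{for all }\varphi\in\mathrm{Dom}(H)\text{ and }\psi\in\mathrm{Dom}(q);$$ in particular $\langle H\varphi,\varphi\rangle=q(\varphi,\varphi)$ for all $\varphi\in\mathrm{Dom}(H)$. Moreover, the domain of $H$ is the set of all $u\in\mathrm{Dom}(q)$ for which there exists $f\in\mathcal H$ such that $q(u,\phi)=\langle f,\phi\rangle$ for all $\phi\in\mathrm{Dom}(q)$. In this case $f$ is unique and $Hu=f$. -/

import Mathlib

open Filter Topology

/-- A sesquilinear form on a complex inner product space `E`, defined on a linear subspace `domain`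
of `E`. The form is linear in its first and antilinear in its second argument; its quadratic form
is `u ↦ q.form u u`. -/
structure SesqForm (E : Type*) [NormedAddCommGroup E] [InnerProductSpace ℂ E] where
  /-- the form domain -/
  domain : Submodule ℂ E
  /-- the values of the form -/
  form : domain →ₗ[ℂ] domain →ₗ⋆[ℂ] ℂ

namespace SesqForm

variable {E : Type*} [NormedAddCommGroup E] [InnerProductSpace ℂ E]

/-- The restriction of (the values of) a form to a smaller domain `D`. -/
def restrictForm (q : SesqForm E) (D : Submodule ℂ E) (h : D ≤ q.domain) :
    D →ₗ[ℂ] D →ₗ⋆[ℂ] ℂ :=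
  LinearMap.mk₂'ₛₗ (RingHom.id ℂ) (starRingEnd ℂ)
    (fun u v => q.form (Submodule.inclusion h u) (Submodule.inclusion h v))
    (by intros; simp) (by intros; simp) (by intros; simp) (by intros; simp)

/-- The sum of two forms, defined on the intersection of the two domains. -/
instance : Add (SesqForm E) where
  add p q :=
    { domain := p.domain ⊓ q.domain
      form := p.restrictForm (p.domain ⊓ q.domain) inf_le_left
        + q.restrictForm (p.domain ⊓ q.domain) inf_le_right }

/-- A complex multiple of a form, on the same domain. -/
instance : SMul ℂ (SesqForm E) where
  smul c q := { domain := q.domain, form := c • q.form }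

/-- `q` is densely defined. -/
def IsDenselyDefined (q : SesqForm E) : Prop := Dense (q.domain : Set E)

/-- `q` is symmetric (Hermitian). -/
def IsSymmetric (q : SesqForm E) : Prop :=
  ∀ u v : q.domain, q.form u v = starRingEnd ℂ (q.form v u)

/-- `q` is bounded from below; for a symmetric form `q u u` is real. -/
def IsBoundedBelow (q : SesqForm E) : Prop :=
  ∃ m : ℝ, ∀ u : q.domain, m * ‖(u : E)‖ ^ 2 ≤ (q.form u u).re

/-- `q` is non-negative; for a symmetric form `q u u` is real. -/
def IsNonneg (q : SesqForm E) : Prop :=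
  ∀ u : q.domain, 0 ≤ (q.form u u).re

/-- `q` is closed: if `uₙ` in the domain of `q` converge to `u` in `E` and
`q (uₙ - uₘ) (uₙ - uₘ) → 0` as `n, m → ∞`, then `u` is in the domain of `q` and
`q (uₙ - u) (uₙ - u) → 0`. -/
def IsClosed (q : SesqForm E) : Prop :=
  ∀ (u : ℕ → q.domain) (x : E),
    Tendsto (fun n => (u n : E)) atTop (𝓝 x) →
    Tendsto (fun k : ℕ × ℕ => q.form (u k.1 - u k.2) (u k.1 - u k.2)) atTop (𝓝 0) →
    ∃ hx : x ∈ q.domain,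
      Tendsto (fun n => q.form (u n - ⟨x, hx⟩) (u n - ⟨x, hx⟩)) atTop (𝓝 0)

/-- `p` is `q`-bounded: it is defined on the domain of `q`, and
`|p(u,u)| ≤ C (|q(u,u)| + ‖u‖²)` there, for some constant `C ≥ 0`. -/
def IsRelBounded (p q : SesqForm E) : Prop :=
  ∃ h : q.domain ≤ p.domain, ∃ C : ℝ, 0 ≤ C ∧ ∀ u : q.domain,
    ‖p.form (Submodule.inclusion h u) (Submodule.inclusion h u)‖
      ≤ C * (‖q.form u u‖ + ‖(u : E)‖ ^ 2)

end SesqForm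

section Dissipative

variable {E : Type*} [NormedAddCommGroup E] [InnerProductSpace ℂ E]

/-- The operator `T` is dissipative: `Im ⟨T φ, φ⟩ ≤ 0` on its domain, for the inner product that is
linear in the first argument. (Mathlib's `inner` is linear in the second argument, so
`⟨a, b⟩` is `inner ℂ b a`.) -/
def IsDissipative (T : E →ₗ.[ℂ] E) : Prop :=
  ∀ φ : T.domain, (inner ℂ (φ : E) (T φ)).im ≤ 0

/-- The operator `T` is maximal dissipative: it is dissipative and has no dissipative extension
other than itself. -/
def IsMaximalDissipative (T : E →ₗ.[ℂ] E) : Prop :=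
  IsDissipative T ∧ ∀ S : E →ₗ.[ℂ] E, IsDissipative S → T ≤ S → S = T

/-- The operator `T` is associated with the form `q`: `Dom(T) ⊆ Dom(q)` and
`⟨T φ, ψ⟩ = q(φ, ψ)` for all `φ ∈ Dom(T)`, `ψ ∈ Dom(q)`. -/
def IsAssociated (T : E →ₗ.[ℂ] E) (q : SesqForm E) : Prop :=
  ∃ h : T.domain ≤ q.domain, ∀ (φ : T.domain) (ψ : q.domain),
    inner ℂ (ψ : E) (T φ) = q.form (Submodule.inclusion h φ) ψ

end Dissipative

/-! Take for `H` the operator whose graph is the set of pairs (u, f) with q(u, ·) = ⟨f, ·⟩. Density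
makes it single-valued, and it extends every operator associated with q (`SesqForm.le_operator`). It
is dissipative because Im q(u, u) = -q_Θ(u, u). For maximality it suffices that H - iλ is onto for
some λ > 0 (`IsDissipative.isMaximalDissipative`). This is Lax–Milgram for q - iλ on Dom(q₀), normed
by q₀ + λ (`SesqForm.IsClosed.exists_forall_eq_inner`): closedness of q₀ gives completeness, the
relative bound and Cauchy–Schwarz give continuity, and the real and imaginary parts together give
coercivity. -/

open scoped InnerProductSpace

/-! ### Lax–Milgram on a Hilbert space. -/

/-- **Lax–Milgram**, complex version: a bounded sesquilinear form which is bounded below on the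
diagonal represents every vector. -/
theorem exists_forall_eq_inner_of_coercive {V : Type*} [NormedAddCommGroup V]
    [InnerProductSpace ℂ V] [CompleteSpace V] (a : V →ₗ[ℂ] V →ₗ⋆[ℂ] ℂ) {C c : ℝ} (hc : 0 < c)
    (hC : ∀ u v, ‖a u v‖ ≤ C * ‖u‖ * ‖v‖) (hcoer : ∀ u, c * ‖u‖ ^ 2 ≤ ‖a u u‖) (g : V) :
    ∃ u, ∀ v, a u v = ⟪v, g⟫_ℂ := by
  -- Conjugation moves the antilinearity to the first argument, as `continuousLinearMapOfBilin`
  -- expects.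
  let b : V →ₗ⋆[ℂ] V →ₗ[ℂ] ℂ := LinearMap.mk₂'ₛₗ (starRingEnd ℂ) (RingHom.id ℂ)
    (fun u v => starRingEnd ℂ (a u v)) (by intros; simp) (by intros; simp) (by intros; simp)
    (by intros; simp)
  let B : V →L⋆[ℂ] V →L[ℂ] ℂ := b.mkContinuous₂ C fun u v => by
    simpa [b] using hC u v
  let T := InnerProductSpace.continuousLinearMapOfBilin B
  have hT : ∀ u v, ⟪T u, v⟫_ℂ = starRingEnd ℂ (a u v) := fun u v =>
    InnerProductSpace.continuousLinearMapOfBilin_apply B u v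
  have hbelow : ∀ u, c * ‖u‖ ≤ ‖T u‖ := by
    intro u
    rcases eq_or_ne u 0 with rfl | hu
    · simp
    have h := norm_inner_le_norm (𝕜 := ℂ) (T u) u
    rw [hT, RCLike.norm_conj] at h
    have hpos : 0 < ‖u‖ := norm_pos_iff.2 hu
    have h2 := hcoer u
    refine le_of_mul_le_mul_right ?_ hpos
    linarith [show c * ‖u‖ * ‖u‖ = c * ‖u‖ ^ 2 by ring]
  have hanti : AntilipschitzWith (c⁻¹).toNNReal T := by
    refine ContinuousLinearMap.antilipschitz_of_bound T fun u => ?_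
    rw [Real.coe_toNNReal _ (inv_pos.2 hc).le, ← div_eq_inv_mul, le_div_iff₀ hc, mul_comm]
    exact hbelow u
  have hclosed : _root_.IsClosed (T.range : Set V) := hanti.isClosed_range T.uniformContinuous
  have hrange : T.range = ⊤ := by
    have := hclosed.completeSpace_coe
    rw [← T.range.orthogonal_orthogonal, Submodule.eq_top_iff']
    -- A vector w orthogonal to the closed range has a(w, w) = 0, so coercivity kills it.
    intro v w hw
    have h0 : ‖a w w‖ = 0 := by
      have h := hw (T w) ⟨w, rfl⟩
      rw [hT] at h
      rw [← RCLike.norm_conj, h, norm_zero]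
    have h1 := hcoer w
    have hw0 : w = 0 := by
      rw [← norm_eq_zero]
      exact pow_eq_zero_iff two_ne_zero |>.1
        (le_antisymm (nonpos_of_mul_nonpos_right (h0 ▸ h1) hc) (sq_nonneg _))
    simp [hw0]
  obtain ⟨u, hu⟩ : g ∈ T.range := hrange ▸ Submodule.mem_top
  refine ⟨u, fun v => ?_⟩
  have h := hT u v
  rw [show T u = g from hu] at h
  rw [← inner_conj_symm, h, Complex.conj_conj]

/-! ### Cauchy–Schwarz and Lax–Milgram for the norm of a Hermitian form. -/

section Hermitian

variable {V : Type*} [AddCommGroup V] [Module ℂ V]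

/-- The semi-inner product given by a non-negative Hermitian form. -/
@[reducible]
def preInnerCoreOfForm (p : V →ₗ[ℂ] V →ₗ⋆[ℂ] ℂ) (hp : ∀ u v, p u v = starRingEnd ℂ (p v u))
    (hnn : ∀ u, 0 ≤ (p u u).re) : PreInnerProductSpace.Core ℂ V where
  inner u v := p v u
  conj_inner_symm u v := (hp v u).symm
  re_inner_nonneg := hnn
  add_left u v w := map_add (p w) u v
  smul_left u v r := by simp

/-- The **Cauchy–Schwarz inequality** for a non-negative Hermitian form. -/
theorem norm_form_le_sqrt_mul_sqrt (p : V →ₗ[ℂ] V →ₗ⋆[ℂ] ℂ)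
    (hp : ∀ u v, p u v = starRingEnd ℂ (p v u)) (hnn : ∀ u, 0 ≤ (p u u).re) (u v : V) :
    ‖p u v‖ ≤ √(p u u).re * √(p v v).re := by
  let c := preInnerCoreOfForm p hp hnn
  let := InnerProductSpace.Core.toSeminormedAddCommGroup (𝕜 := ℂ) (F := V)
  have h := InnerProductSpace.Core.norm_inner_le_norm (𝕜 := ℂ) (F := V) v u
  rw [mul_comm]
  exact h

/-- **Lax–Milgram** on a space which is complete for the norm `√(p u u)` of a positive definite
Hermitian form `p`. -/
theorem exists_forall_eq_of_coercive_form (p a : V →ₗ[ℂ] V →ₗ⋆[ℂ] ℂ)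
    (hp : ∀ u v, p u v = starRingEnd ℂ (p v u)) (hnn : ∀ u, 0 ≤ (p u u).re)
    (hdef : ∀ u, p u u = 0 → u = 0)
    (hcomplete : ∀ x : ℕ → V,
      Tendsto (fun k : ℕ × ℕ => (p (x k.1 - x k.2) (x k.1 - x k.2)).re) atTop (𝓝 0) →
      ∃ y, Tendsto (fun n => (p (x n - y) (x n - y)).re) atTop (𝓝 0))
    {C c : ℝ} (hc : 0 < c) (hC : ∀ u v, ‖a u v‖ ≤ C * √(p u u).re * √(p v v).re)
    (hcoer : ∀ u, c * (p u u).re ≤ ‖a u u‖)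
    (l : V →ₗ⋆[ℂ] ℂ) {K : ℝ} (hl : ∀ v, ‖l v‖ ≤ K * √(p v v).re) :
    ∃ u, ∀ v, a u v = l v := by
  let core : InnerProductSpace.Core ℂ V :=
    { preInnerCoreOfForm p hp hnn with definite := hdef }
  -- `V` is a bare module up to here, so this norm cannot clash with the one a form domain inherits
  -- from the ambient space.
  let : NormedAddCommGroup V := core.toNormedAddCommGroup
  let : InnerProductSpace ℂ V := InnerProductSpace.ofCore core.toCore
  have hnorm : ∀ u : V, ‖u‖ = √(p u u).re := fun u => rfl
  have hsq : ∀ u : V, ‖u‖ ^ 2 = (p u u).re := fun u => by rw [hnorm, Real.sq_sqrt (hnn u)]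
  have : CompleteSpace V := by
    refine Metric.complete_of_cauchySeq_tendsto fun x hx => ?_
    obtain ⟨y, hy⟩ := hcomplete x (by
      have h := ((cauchySeq_iff_tendsto_dist_atTop_0).1 hx).pow 2
      simpa [dist_eq_norm, hsq] using h)
    refine ⟨y, tendsto_iff_norm_sub_tendsto_zero.2 ?_⟩
    have h := hy.sqrt
    rw [Real.sqrt_zero] at h
    exact h
  let L : V →ₗ[ℂ] ℂ :=
    { toFun := fun v => starRingEnd ℂ (l v)
      map_add' := by intros; simp
      map_smul' := by intros; simp }
  let L' : StrongDual ℂ V := L.mkContinuous K fun v => by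
    simpa [L, hnorm] using hl v
  obtain ⟨u, hu⟩ := exists_forall_eq_inner_of_coercive a hc hC
    (fun u => by rw [hsq]; exact hcoer u) ((InnerProductSpace.toDual ℂ V).symm L')
  refine ⟨u, fun v => ?_⟩
  rw [hu, ← inner_conj_symm, InnerProductSpace.toDual_symm_apply]
  exact Complex.conj_conj _

end Hermitian

/-! ### Maximality from surjectivity, and the operator of a form. -/

section Operator

variable {E : Type*} [NormedAddCommGroup E] [InnerProductSpace ℂ E]

/-- A dissipative operator `T` for which `T - i lam` is onto, for some `lam > 0`, is maximal
dissipative. -/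
theorem IsDissipative.isMaximalDissipative {T : E →ₗ.[ℂ] E} (hT : IsDissipative T) {lam : ℝ}
    (hlam : 0 < lam)
    (hsurj : ∀ g : E, ∃ u : T.domain, T u - (lam * Complex.I : ℂ) • (u : E) = g) :
    IsMaximalDissipative T := by
  refine ⟨hT, fun S hS hTS => (LinearPMap.eq_of_le_of_domain_eq hTS ?_).symm⟩
  refine le_antisymm hTS.1 fun v hv => ?_
  -- With (T - iλ)u = (S - iλ)v, the difference w = v - u satisfies Sw = iλw. Then Im ⟨Sw, w⟩ =
  -- λ‖w‖² ≤ 0 forces v = u.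
  obtain ⟨u, hu⟩ := hsurj (S ⟨v, hv⟩ - (lam * Complex.I : ℂ) • v)
  let u' : S.domain := ⟨u, hTS.1 u.2⟩
  have huu : T u = S u' := hTS.2 rfl
  have hw : S (⟨v, hv⟩ - u') = (lam * Complex.I : ℂ) • (v - u : E) := by
    rw [LinearPMap.map_sub, ← huu, smul_sub, sub_eq_sub_iff_sub_eq_sub, ← hu]
  have h := hS (⟨v, hv⟩ - u')
  rw [hw, inner_smul_right] at h
  have h' : lam * ‖(v - u : E)‖ ^ 2 ≤ 0 := by
    have e : (⟪((⟨v, hv⟩ - u' : S.domain) : E), (v - u : E)⟫_ℂ) = ((‖(v - u : E)‖ ^ 2 : ℝ) : ℂ) := by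
      rw [Complex.ofReal_pow]
      exact inner_self_eq_norm_sq_to_K (𝕜 := ℂ) (v - u : E)
    rw [e] at h
    simpa [mul_assoc, ← Complex.ofReal_pow] using h
  have h0 : ‖(v - u : E)‖ = 0 := pow_eq_zero_iff two_ne_zero |>.1
    (le_antisymm (nonpos_of_mul_nonpos_right h' hlam) (sq_nonneg _))
  rw [sub_eq_zero.1 (norm_eq_zero.1 h0)]
  exact u.2

namespace SesqForm

variable (q : SesqForm E)

/-- The pairs `(u, f)` with `u` in the form domain and `q u φ = ⟨f, φ⟩` for all `φ` in the form
domain. -/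
def operatorGraph : Submodule ℂ (E × E) where
  carrier := {x | ∃ hu : x.1 ∈ q.domain, ∀ φ : q.domain, q.form ⟨x.1, hu⟩ φ = ⟪(φ : E), x.2⟫_ℂ}
  add_mem' := by
    rintro x y ⟨hx, hxf⟩ ⟨hy, hyf⟩
    refine ⟨q.domain.add_mem hx hy, fun φ => ?_⟩
    rw [Prod.snd_add, inner_add_right, ← hxf, ← hyf, ← LinearMap.add_apply, ← map_add]
    rfl
  zero_mem' := ⟨q.domain.zero_mem, fun φ => by
    rw [Prod.snd_zero, inner_zero_right, show (⟨(0 : E × E).1, q.domain.zero_mem⟩ : q.domain) = 0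
      from rfl, map_zero, LinearMap.zero_apply]⟩
  smul_mem' := by
    rintro c x ⟨hx, hxf⟩
    refine ⟨q.domain.smul_mem c hx, fun φ => ?_⟩
    rw [Prod.smul_snd, inner_smul_right, ← hxf, ← smul_eq_mul, ← LinearMap.smul_apply, ← map_smul]
    rfl

/-- The operator associated with a form, with the largest possible domain. -/
noncomputable def operator : E →ₗ.[ℂ] E := q.operatorGraph.toLinearPMap

variable {q}

theorem mem_graph_operator (hq : q.IsDenselyDefined) {u f : E} :
    (u, f) ∈ q.operator.graph ↔
      ∃ hu : u ∈ q.domain, ∀ φ : q.domain, q.form ⟨u, hu⟩ φ = ⟪(φ : E), f⟫_ℂ := by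
  rw [operator, Submodule.toLinearPMap_graph_eq]
  · exact Iff.rfl
  -- If (0, f) is in the graph, f is orthogonal to the dense form domain, hence zero.
  · rintro ⟨x, f⟩ ⟨hx, hf⟩ rfl
    refine hq.eq_of_inner_right (𝕜 := ℂ) fun v hv => ?_
    rw [inner_zero_right, ← hf ⟨v, hv⟩]
    exact DFunLike.congr_fun (map_zero q.form) _

theorem mem_domain_operator (hq : q.IsDenselyDefined) {u : E} :
    u ∈ q.operator.domain ↔
      ∃ hu : u ∈ q.domain, ∃ f : E, ∀ φ : q.domain, q.form ⟨u, hu⟩ φ = ⟪(φ : E), f⟫_ℂ := by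
  rw [LinearPMap.mem_domain_iff]
  simp only [mem_graph_operator hq]
  exact exists_comm

theorem operator_apply_eq_iff (hq : q.IsDenselyDefined) (u : q.operator.domain)
    (hu : (u : E) ∈ q.domain) (f : E) :
    (∀ φ : q.domain, q.form ⟨u, hu⟩ φ = ⟪(φ : E), f⟫_ℂ) ↔ q.operator u = f := by
  have h := mem_graph_operator hq (u := u) (f := f)
  rw [exists_prop_of_true hu] at h
  rw [← h, LinearPMap.mem_graph_iff]
  constructor
  · rintro ⟨y, hy, hf⟩
    rwa [Subtype.ext hy] at hf
  · exact fun hf => ⟨u, rfl, hf⟩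

theorem isAssociated_operator (hq : q.IsDenselyDefined) : IsAssociated q.operator q := by
  have hle : q.operator.domain ≤ q.domain := fun u hu => ((mem_domain_operator hq).1 hu).1
  exact ⟨hle, fun φ ψ => ((operator_apply_eq_iff hq φ (hle φ.2) _).2 rfl ψ).symm⟩

/-- The source of uniqueness: once `q.operator` is dissipative, a maximal dissipative operator
associated with q must equal it. -/
theorem le_operator (hq : q.IsDenselyDefined) {T : E →ₗ.[ℂ] E} (hT : IsAssociated T q) :
    T ≤ q.operator := by
  obtain ⟨hle, h⟩ := hT
  refine LinearPMap.le_of_le_graph ?_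
  rintro ⟨u, f⟩ huf
  obtain ⟨y, rfl, rfl⟩ := (LinearPMap.mem_graph_iff T).1 huf
  exact (mem_graph_operator hq).2 ⟨hle y.2, fun φ => (h y φ).symm⟩

/-! ### Completeness of the form domain and solvability of the shifted equation. -/

/-- The form domain of a closed form `q` is complete for the norm given by `q + lam`, if that form
dominates the norm of the space. -/
theorem IsClosed.exists_tendsto [CompleteSpace E] (hq : q.IsClosed) (hs : q.IsSymmetric) {lam : ℝ}
    (hlam : ∀ u : q.domain, ‖(u : E)‖ ^ 2 ≤ (q.form u u).re + lam * ‖(u : E)‖ ^ 2)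
    (x : ℕ → q.domain)
    (hx : Tendsto (fun k : ℕ × ℕ => (q.form (x k.1 - x k.2) (x k.1 - x k.2)).re
      + lam * ‖((x k.1 - x k.2 : q.domain) : E)‖ ^ 2) atTop (𝓝 0)) :
    ∃ y : q.domain, Tendsto (fun n => (q.form (x n - y) (x n - y)).re
      + lam * ‖((x n - y : q.domain) : E)‖ ^ 2) atTop (𝓝 0) := by
  have hre : ∀ u : q.domain, (((q.form u u).re : ℝ) : ℂ) = q.form u u := fun u =>
    Complex.conj_eq_iff_re.1 (hs u u).symm
  have h1 : Tendsto (fun k : ℕ × ℕ => ‖((x k.1 - x k.2 : q.domain) : E)‖ ^ 2) atTop (𝓝 0) :=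
    squeeze_zero (fun _ => sq_nonneg _) (fun k => hlam _) hx
  have hcau : CauchySeq fun n => (x n : E) := by
    rw [cauchySeq_iff_tendsto_dist_atTop_0]
    simpa [dist_eq_norm] using h1.sqrt
  obtain ⟨z, hz⟩ := cauchySeq_tendsto_of_complete hcau
  -- Removing the λ‖·‖² term, which tends to zero, leaves the Cauchy condition in the definition of
  -- closedness.
  obtain ⟨hzq, hlim⟩ := hq x z hz (by
    have h := (hx.sub (h1.const_mul lam)).ofReal
    simpa only [add_sub_cancel_right, hre, mul_zero, sub_zero, Complex.ofReal_zero] using h)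
  refine ⟨⟨z, hzq⟩, ?_⟩
  have h2 : Tendsto (fun n => ‖((x n - ⟨z, hzq⟩ : q.domain) : E)‖ ^ 2) atTop (𝓝 0) := by
    simpa using (tendsto_iff_norm_sub_tendsto_zero.1 hz).pow 2
  simpa using (Complex.continuous_re.tendsto _ |>.comp hlim).add (h2.const_mul lam)

/-- The inner product of the space, as a form on a subspace. -/
noncomputable def innerForm (D : Submodule ℂ E) : D →ₗ[ℂ] D →ₗ⋆[ℂ] ℂ :=
  LinearMap.mk₂'ₛₗ (RingHom.id ℂ) (starRingEnd ℂ) (fun u v => ⟪(v : E), (u : E)⟫_ℂ)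
    (fun _ _ _ => inner_add_right _ _ _) (fun _ _ _ => inner_smul_right _ _ _)
    (fun _ _ _ => inner_add_left _ _ _) (fun _ _ _ => inner_smul_left _ _ _)

theorem innerForm_apply {D : Submodule ℂ E} (u v : D) :
    innerForm D u v = ⟪(v : E), (u : E)⟫_ℂ := rfl

theorem innerForm_self {D : Submodule ℂ E} (u : D) :
    innerForm D u u = ((‖(u : E)‖ ^ 2 : ℝ) : ℂ) := by
  rw [Complex.ofReal_pow]
  exact inner_self_eq_norm_sq_to_K (𝕜 := ℂ) (u : E)

/-- Let `q` be closed, symmetric and bounded below, and let `s` be a symmetric, non-negative form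
on the domain of `q` which is `q`-bounded. Then the form `q - i s - i lam` represents every vector,
if `lam` is large. -/
theorem IsClosed.exists_forall_eq_inner [CompleteSpace E] (hq : q.IsClosed) (hs : q.IsSymmetric)
    (hb : q.IsBoundedBelow) (s : q.domain →ₗ[ℂ] q.domain →ₗ⋆[ℂ] ℂ)
    (hss : ∀ u v, s u v = starRingEnd ℂ (s v u)) (hsn : ∀ u, 0 ≤ (s u u).re) {C : ℝ} (hC : 0 ≤ C)
    (hsb : ∀ u, ‖s u u‖ ≤ C * (‖q.form u u‖ + ‖(u : E)‖ ^ 2)) :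
    ∃ lam : ℝ, 0 < lam ∧ ∀ g : E, ∃ u : q.domain, ∀ v : q.domain,
      q.form u v - Complex.I * s u v - lam * Complex.I * ⟪(v : E), (u : E)⟫_ℂ = ⟪(v : E), g⟫_ℂ := by
  obtain ⟨m, hm⟩ := hb
  -- |m| offsets the lower bound of q; the extra 1 makes q + λ dominate ‖·‖².
  let lam : ℝ := |m| + 1
  have hlam : 0 < lam := by positivity
  have hdom : ∀ u : q.domain, ‖(u : E)‖ ^ 2 ≤ (q.form u u).re + lam * ‖(u : E)‖ ^ 2 := fun u => by
    have h1 := mul_le_mul_of_nonneg_right (neg_abs_le m) (sq_nonneg ‖(u : E)‖)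
    linarith [hm u, show lam * ‖(u : E)‖ ^ 2 = |m| * ‖(u : E)‖ ^ 2 + ‖(u : E)‖ ^ 2 by ring]
  let p : q.domain →ₗ[ℂ] q.domain →ₗ⋆[ℂ] ℂ := q.form + (lam : ℂ) • innerForm q.domain
  let a : q.domain →ₗ[ℂ] q.domain →ₗ⋆[ℂ] ℂ :=
    q.form - Complex.I • s - (lam * Complex.I : ℂ) • innerForm q.domain
  have hp : ∀ u v, p u v = q.form u v + lam * ⟪(v : E), (u : E)⟫_ℂ := fun u v => rfl
  have ha : ∀ u v, a u v =
      q.form u v - Complex.I * s u v - lam * Complex.I * ⟪(v : E), (u : E)⟫_ℂ := fun u v => rfl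
  have hpre : ∀ u, (p u u).re = (q.form u u).re + lam * ‖(u : E)‖ ^ 2 := fun u => by
    rw [hp, ← innerForm_apply, innerForm_self, ← Complex.ofReal_mul, Complex.add_re,
      Complex.ofReal_re]
  have hpsymm : ∀ u v, p u v = starRingEnd ℂ (p v u) := fun u v => by
    rw [hp, hp, map_add, map_mul, inner_conj_symm, ← hs, Complex.conj_ofReal]
  have hpdom : ∀ u : q.domain, ‖(u : E)‖ ^ 2 ≤ (p u u).re := fun u => hpre u ▸ hdom u
  have hpnn : ∀ u, 0 ≤ (p u u).re := fun u => (sq_nonneg _).trans (hpdom u)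
  have hnorm : ∀ u : q.domain, ‖(u : E)‖ ≤ √(p u u).re := fun u => Real.le_sqrt_of_sq_le (hpdom u)
  have hqim : ∀ u, (q.form u u).im = 0 := fun u => Complex.conj_eq_iff_im.1 (hs u u).symm
  have hsim : ∀ u, (s u u).im = 0 := fun u => Complex.conj_eq_iff_im.1 (hss u u).symm
  have hinner : ∀ u v : q.domain, ‖⟪(v : E), (u : E)⟫_ℂ‖ ≤ √(p u u).re * √(p v v).re := fun u v => by
    refine (norm_inner_le_norm _ _).trans ?_
    rw [mul_comm]
    exact mul_le_mul (hnorm u) (hnorm v) (norm_nonneg _) (Real.sqrt_nonneg _)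
  have hqb : ∀ u v, ‖q.form u v‖ ≤ (1 + lam) * (√(p u u).re * √(p v v).re) := fun u v => by
    -- q need not be non-negative, so Cauchy–Schwarz is applied to p = q + λ and the shift is
    -- subtracted.
    have e : q.form u v = p u v - lam * ⟪(v : E), (u : E)⟫_ℂ := by rw [hp]; ring
    have h := norm_sub_le (p u v) (lam * ⟪(v : E), (u : E)⟫_ℂ)
    rw [← e, norm_mul, Complex.norm_of_nonneg hlam.le] at h
    linarith [norm_form_le_sqrt_mul_sqrt p hpsymm hpnn u v,
      mul_le_mul_of_nonneg_left (hinner u v) hlam.le]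
  have hsre : ∀ u, (s u u).re ≤ (C * (2 + lam)) * (p u u).re := fun u => by
    have h1 := hqb u u
    rw [Real.mul_self_sqrt (hpnn u)] at h1
    calc (s u u).re ≤ ‖s u u‖ := Complex.re_le_norm _
      _ ≤ C * (‖q.form u u‖ + ‖(u : E)‖ ^ 2) := hsb u
      _ ≤ C * ((1 + lam) * (p u u).re + (p u u).re) := by gcongr; exact hpdom u
      _ = _ := by ring
  have hK : 0 ≤ C * (2 + lam) := by positivity
  have hsbd : ∀ u v, ‖s u v‖ ≤ C * (2 + lam) * (√(p u u).re * √(p v v).re) := fun u v => by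
    -- The relative bound controls only the diagonal; Cauchy–Schwarz for s extends it to all pairs.
    have h : ∀ w, √(s w w).re ≤ √(C * (2 + lam)) * √(p w w).re := fun w => by
      rw [← Real.sqrt_mul hK]
      exact Real.sqrt_le_sqrt (hsre w)
    calc ‖s u v‖ ≤ √(s u u).re * √(s v v).re := norm_form_le_sqrt_mul_sqrt s hss hsn u v
      _ ≤ (√(C * (2 + lam)) * √(p u u).re) * (√(C * (2 + lam)) * √(p v v).re) :=
        mul_le_mul (h u) (h v) (Real.sqrt_nonneg _) (by positivity)
      _ = (√(C * (2 + lam)) * √(C * (2 + lam))) * (√(p u u).re * √(p v v).re) := by ring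
      _ = _ := by rw [Real.mul_self_sqrt hK]
  refine ⟨lam, hlam, fun g => ?_⟩
  let l : q.domain →ₗ⋆[ℂ] ℂ :=
    { toFun := fun v => ⟪(v : E), g⟫_ℂ
      map_add' := fun _ _ => inner_add_left _ _ _
      map_smul' := fun _ _ => inner_smul_left _ _ _ }
  refine exists_forall_eq_of_coercive_form p a hpsymm hpnn (fun u hu => ?_) (fun x hx => ?_)
    (C := 1 + lam + C * (2 + lam) + lam) (c := 1 / 2) (by norm_num) (fun u v => ?_) (fun u => ?_)
    l (K := ‖g‖) (fun v => ?_)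
  · have h := hpdom u
    rw [hu, Complex.zero_re] at h
    exact Subtype.ext (norm_eq_zero.1
      (pow_eq_zero_iff two_ne_zero |>.1 (le_antisymm h (sq_nonneg _))))
  · simp only [hpre] at hx ⊢
    exact hq.exists_tendsto hs hdom x hx
  · have h1 := norm_sub_le (q.form u v - Complex.I * s u v)
      (lam * Complex.I * ⟪(v : E), (u : E)⟫_ℂ)
    have h2 := norm_sub_le (q.form u v) (Complex.I * s u v)
    rw [← ha, norm_mul, norm_mul, Complex.norm_I, mul_one, Complex.norm_of_nonneg hlam.le] at h1
    rw [norm_mul, Complex.norm_I, one_mul] at h2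
    rw [mul_assoc]
    linarith [hqb u v, hsbd u v, mul_le_mul_of_nonneg_left (hinner u v) hlam.le]
  -- Re a - Im a = q + s + λ‖u‖² ≥ p on the diagonal, and each of Re a, -Im a is at most |a|; hence
  -- the constant 1/2.
  · have hre : (a u u).re = (q.form u u).re := by
      rw [ha, ← innerForm_apply, innerForm_self]
      simp [hsim, -Complex.ofReal_pow]
    have him : (a u u).im = -(s u u).re - lam * ‖(u : E)‖ ^ 2 := by
      rw [ha, ← innerForm_apply, innerForm_self]
      simp [hqim, -Complex.ofReal_pow]
    have h1 := Complex.re_le_norm (a u u)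
    have h2 := (neg_le_abs _).trans (Complex.abs_im_le_norm (a u u))
    linarith [hsn u, hpre u]
  · rw [mul_comm]
    exact (norm_inner_le_norm _ _).trans
      (mul_le_mul_of_nonneg_right (hnorm v) (norm_nonneg _))

end SesqForm

end Operator

/-! ### The representation theorem for q₀ - i q_Θ. -/

theorem mainTheorem10 {E : Type*} [NormedAddCommGroup E] [InnerProductSpace ℂ E] [CompleteSpace E]
    (q₀ qΘ q : SesqForm E)
    (h₀_dense : q₀.IsDenselyDefined) (h₀_closed : q₀.IsClosed)
    (h₀_symm : q₀.IsSymmetric) (h₀_below : q₀.IsBoundedBelow)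
    (hΘ_symm : qΘ.IsSymmetric) (hΘ_nonneg : qΘ.IsNonneg)
    (hΘ_bdd : qΘ.IsRelBounded q₀)
    (hq : q = q₀ + (-Complex.I) • qΘ) :
    q.domain = q₀.domain ∧
    ∃ H : E →ₗ.[ℂ] E,
      -- existence of a maximal dissipative operator associated with `q`
      IsMaximalDissipative H ∧ IsAssociated H q ∧
      (∃ h : H.domain ≤ q.domain, ∀ φ : H.domain,
        inner ℂ (φ : E) (H φ) =
          q.form (Submodule.inclusion h φ) (Submodule.inclusion h φ)) ∧
      -- uniqueness
      (∀ H' : E →ₗ.[ℂ] E, IsMaximalDissipative H' → IsAssociated H' q → H' = H) ∧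
      -- the domain of `H`
      (∀ u : E, u ∈ H.domain ↔
        ∃ hu : u ∈ q.domain, ∃ f : E, ∀ φ : q.domain, q.form ⟨u, hu⟩ φ = inner ℂ (φ : E) f) ∧
      -- for `u` in the domain, `f` is unique and is `H u`
      (∀ (u : H.domain) (hu : (u : E) ∈ q.domain) (f : E),
        (∀ φ : q.domain, q.form ⟨u, hu⟩ φ = inner ℂ (φ : E) f) ↔ H u = f) := by
  obtain ⟨hle, C, hC, hCb⟩ := hΘ_bdd
  have hdom : q.domain = q₀.domain := by
    rw [hq]
    exact inf_eq_left.2 hle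
  have hform : ∀ u v : q.domain, q.form u v =
      q₀.form ⟨u, hdom ▸ u.2⟩ ⟨v, hdom ▸ v.2⟩ -
        Complex.I * qΘ.restrictForm q₀.domain hle ⟨u, hdom ▸ u.2⟩ ⟨v, hdom ▸ v.2⟩ := by
    subst hq
    intro u v
    rw [sub_eq_add_neg, ← neg_mul]
    rfl
  have hdense : q.IsDenselyDefined := by
    rw [SesqForm.IsDenselyDefined, hdom]
    exact h₀_dense
  have hassoc := SesqForm.isAssociated_operator hdense
  obtain ⟨hsub, hval⟩ := id hassoc
  have hdiss : IsDissipative q.operator := fun φ => by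
    refine (congrArg Complex.im (hval φ (Submodule.inclusion hsub φ))).trans_le ?_
    rw [hform, Complex.sub_im, Complex.I_mul_im,
      Complex.conj_eq_iff_im.1 (h₀_symm _ _).symm, zero_sub, neg_nonpos]
    exact hΘ_nonneg _
  obtain ⟨lam, hlam, hsolve⟩ := h₀_closed.exists_forall_eq_inner h₀_symm h₀_below
    (qΘ.restrictForm q₀.domain hle) (fun _ _ => hΘ_symm _ _) (fun _ => hΘ_nonneg _) hC hCb
  have hmax : IsMaximalDissipative q.operator := by
    refine hdiss.isMaximalDissipative hlam fun g => ?_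
    obtain ⟨u, hu⟩ := hsolve g
    have huq : (u : E) ∈ q.domain := by rw [hdom]; exact u.2
    -- The equation (q - iλ)(u, ·) = ⟨g, ·⟩ says that u lies in the operator domain with image g +
    -- iλu.
    have hrep : ∀ φ : q.domain, q.form ⟨u, huq⟩ φ =
        ⟪(φ : E), g + (lam * Complex.I : ℂ) • (u : E)⟫_ℂ := fun φ => by
      rw [hform, inner_add_right, inner_smul_right, ← hu ⟨φ, hdom ▸ φ.2⟩, sub_add_cancel]
    have hu' := (SesqForm.mem_domain_operator hdense).2 ⟨huq, _, hrep⟩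
    refine ⟨⟨u, hu'⟩, ?_⟩
    rw [(SesqForm.operator_apply_eq_iff hdense ⟨u, hu'⟩ huq _).1 hrep, add_sub_cancel_right]
  refine ⟨hdom, q.operator, hmax, hassoc, ⟨hsub, fun φ => hval φ (Submodule.inclusion hsub φ)⟩,
    fun H' hH' hH'q => (hH'.2 _ hdiss (SesqForm.le_operator hdense hH'q)).symm,
    fun u => SesqForm.mem_domain_operator hdense,
    fun u hu f => SesqForm.operator_apply_eq_iff hdense u hu f⟩
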